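/- Let $p$ be an odd prime, and let $G$ be a group of exponent $p$, nilpotent of class at most $2$, generated by $g_1,\dots,g_n$ with $n>1$, and not generated by fewer than $n$ elements. Write $[x,y]=x^{-1}y^{-1}xy$, $Z(H)$ for the center of a group $H$, and $H_1=H$, $H_{m+1}=[H_m,H]$ for its lower central series. Call $G$ capable if $G\cong H/Z(H)$ for some group $H$. Let $A_1,\dots,A_n$ be cyclic groups of order $p$ generated by $x_1,\dots,x_n$, let $F=A_1*\cdots*A_n$ be their free product, and let $\mathcal G=F/F_3$ and $K=F/F_4$ be their $2$-nilpotent and $3$-nilpotent products. Let $N$ be the kernel of the homomorphism $\mathcal G\to G$ induced by $x_i\mapsto g_i$. Then $N$ is contained in $[\mathcal G,\mathcal G]$; identify $[\mathcal G,\mathcal G]$ with the subgroup of $K$ generated by the commutators $[x_j,x_i]$, $1\le i<j\le n$, by matching $[x_j,x_i]\in\mathcal G$ with $[x_j,x_i]\in K$, and so regard $N$ as a subgroup of $K$ (thus $N$ consists of those elements of the subgroup of $K$ generated by the $[x_j,x_i]$ whose image under the canonical projection $K\to\mathcal G$ lies in the kernel). Then: (1) $G$ is capable if and only if every element $k\in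 K$ of the form $$k=\prod_{1\le i<j\le n}[x_j,x_i]^{a_{ji}},\qquad 0\le a_{ji}<p,$$ which satisfies $[k,x_i]\in[N,K]$ for $i=1,\dots,n$ lies in $N$. (2) $G$ is capable if and only if $G\cong (K/[N,K])/Z(K/[N,K])$. -/

import Mathlib

universe u v w

namespace Capability

/-- A group is capable if it is isomorphic to `H ⧸ Z(H)` for some group `H`. (It is no restriction
that `H` lives in the universe of `G`: a witness `H` in any universe contains another one, generated
by lifts of the elements of `G`, whose cardinality is at most that of `G` or countable.) -/
def IsCapable (G : Type u) [Group G] : Prop :=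
  ∃ (H : Type u) (_ : Group H), Nonempty (G ≃* H ⧸ Subgroup.center H)

/-- The commutator `[x, y] = x⁻¹ y⁻¹ x y`. -/
def comm {G : Type*} [Group G] (x y : G) : G := x⁻¹ * y⁻¹ * x * y

/-- The subgroup commutator `⁅H, L⁆` of Mathlib (formed with `x y x⁻¹ y⁻¹`) is also the subgroup
generated by the commutators `x⁻¹ y⁻¹ x y`. -/
theorem commutator_eq_closure_comm {G : Type*} [Group G] (H L : Subgroup G) :
    ⁅H, L⁆ = Subgroup.closure {c | ∃ a ∈ H, ∃ b ∈ L, c = comm a b} := by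
  apply le_antisymm
  · rw [Subgroup.commutator_le]
    intro a ha b hb
    refine Subgroup.subset_closure ⟨a⁻¹, inv_mem ha, b⁻¹, inv_mem hb, ?_⟩
    simp [comm, commutatorElement_def]
  · rw [Subgroup.closure_le]
    rintro c ⟨a, ha, b, hb, rfl⟩
    have h := Subgroup.commutator_mem_commutator (inv_mem ha) (inv_mem hb)
    simpa [comm, commutatorElement_def] using h

/-- `[H, G]` is normal in `G` for every subgroup `H`. -/
instance commutator_top_normal {G : Type*} [Group G] (H : Subgroup G) :
    (⁅H, (⊤ : Subgroup G)⁆).Normal := by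
  rw [← Subgroup.normalizer_eq_top_iff, eq_top_iff]
  exact Subgroup.normalizer_commutator_ge_right H ⊤

section NilpotentProduct

variable {ι : Type w} (k : ℕ) (A : ι → Type v) [∀ i, Group (A i)]

/-- The `k`-nilpotent product `F / F_{k+1}` of the groups `A i`, where `F` is their free product.
Mathlib numbers the lower central series from `0`, so that the term `F_{k+1}` of the series with
`F_1 = F` and `F_{m+1} = [F_m, F]` is `(⊤ : Subgroup F).lowerCentralSeries k`. -/
abbrev NilpotentProduct : Type (max w v) :=
  Monoid.CoprodI A ⧸ (⊤ : Subgroup (Monoid.CoprodI A)).lowerCentralSeries k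

variable {A}

/-- The canonical homomorphism from a factor to the `k`-nilpotent product. -/
def NilpotentProduct.of {i : ι} : A i →* NilpotentProduct k A :=
  (QuotientGroup.mk' _).comp Monoid.CoprodI.of

/-- The homomorphism to a group `G` of class at most `k` from the `k`-nilpotent product of cyclic
groups `A i`, generated by `x i`, that is induced by `x i ↦ g i`. -/
noncomputable def NilpotentProduct.induced {G : Type u} [Group G] {x : (i : ι) → A i} {g : ι → G}
    (hx : ∀ i, ∀ b : A i, b ∈ Subgroup.zpowers (x i))
    (hg : ∀ i, orderOf (g i) ∣ orderOf (x i))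
    (hG : (⊤ : Subgroup G).lowerCentralSeries k = ⊥) : NilpotentProduct k A →* G :=
  QuotientGroup.lift _
    (Monoid.CoprodI.lift fun i => monoidHomOfForallMemZpowers (hx i) (hg i)) (by
      refine (Subgroup.map_eq_bot_iff _).mp ?_
      rw [Subgroup.map_lowerCentralSeries, eq_bot_iff, ← hG]
      exact Subgroup.lowerCentralSeries_mono _ le_top)

theorem NilpotentProduct.induced_of {G : Type u} [Group G] {x : (i : ι) → A i} {g : ι → G}
    (hx : ∀ i, ∀ b : A i, b ∈ Subgroup.zpowers (x i))
    (hg : ∀ i, orderOf (g i) ∣ orderOf (x i))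
    (hG : (⊤ : Subgroup G).lowerCentralSeries k = ⊥) (i : ι) :
    NilpotentProduct.induced k hx hg hG (NilpotentProduct.of k (x i)) = g i := by
  simp [NilpotentProduct.induced, NilpotentProduct.of]

variable (A) in
/-- The canonical projection from the `3`-nilpotent product to the `2`-nilpotent product. -/
def NilpotentProduct.proj : NilpotentProduct 3 A →* NilpotentProduct 2 A :=
  QuotientGroup.map _ _ (MonoidHom.id _)
    (Subgroup.lowerCentralSeries_antitone _ (by norm_num : 2 ≤ 3))

end NilpotentProduct

section Candidate

variable {n : ℕ} {A : Fin n → Type v} [∀ i, Group (A i)] (x : (i : Fin n) → A i)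

/-- The subgroup of the `3`-nilpotent product generated by the basic commutators
`[x_j, x_i]`, `i < j`. -/
def basicCommutatorSubgroup : Subgroup (NilpotentProduct 3 A) :=
  Subgroup.closure
    {c | ∃ i j, i < j ∧ c = comm (NilpotentProduct.of 3 (x j)) (NilpotentProduct.of 3 (x i))}

/-- For a subgroup `N` of the commutator subgroup of the `2`-nilpotent product, the corresponding
subgroup of the `3`-nilpotent product `K`. The commutator subgroup of the `2`-nilpotent product is
identified with the subgroup of `K` generated by the `[x_j, x_i]`, `i < j`, by matching
`[x_j, x_i]` with `[x_j, x_i]`; the projection of `K` onto the `2`-nilpotent product does this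
matching, so the subgroup that corresponds to `N` consists of the elements of the latter
subgroup that project into `N`. -/
def liftedSubgroup (N : Subgroup (NilpotentProduct 2 A)) : Subgroup (NilpotentProduct 3 A) :=
  basicCommutatorSubgroup x ⊓ N.comap (NilpotentProduct.proj A)

/-- The group `K / [N, K]`, where `K` is the `3`-nilpotent product and `N` is identified with the
corresponding subgroup of `K`. -/
abbrev Candidate (N : Subgroup (NilpotentProduct 2 A)) : Type v :=
  NilpotentProduct 3 A ⧸ ⁅liftedSubgroup x N, (⊤ : Subgroup (NilpotentProduct 3 A))⁆

/-- The product `∏_{i < j} [x_j, x_i] ^ (a j i)` in the `3`-nilpotent product, its factors in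
lexicographic order of the pairs `(i, j)`. (The factors commute.) -/
def basicCommutatorProduct (a : Fin n → Fin n → ℕ) : NilpotentProduct 3 A :=
  ((List.finRange n).flatMap fun i =>
    ((List.finRange n).filter fun j => i < j).map fun j =>
      comm (NilpotentProduct.of 3 (x j)) (NilpotentProduct.of 3 (x i)) ^ a j i).prod

end Candidate

/-- In a group of exponent `p`, the order of any element divides that of a generator of a
cyclic group of order `p`. -/
theorem orderOf_dvd_of_card_eq {p : ℕ} {G : Type u} [Group G] (hexp : Monoid.exponent G = p)
    {B : Type v} [Group B] (hB : Nat.card B = p) {x : B}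
    (hx : ∀ b : B, b ∈ Subgroup.zpowers x) (g : G) : orderOf g ∣ orderOf x := by
  rw [orderOf_eq_card_of_forall_mem_zpowers hx, hB, ← hexp]
  exact Monoid.order_dvd_exponent g

end Capability

/-! Let `f : K → G` be the composite map, `B` the subgroup generated by the basic commutators, `L =
B ⊓ f.ker` the lift of `N`, and `D = ⁅L, ⊤⁆`. The proof is a cycle: capable, then the condition on
`k`, then `G ≅ (K/D)/Z(K/D)`, then capable.

If `G` is capable, `IsCapable.exists_lift` gives `E` with `E/Z(E) ≅ G` in which the `g i` lift to
elements of order dividing `p`. As `E` has class at most 3, `f` factors through a map `K → E`. It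
sends `L` into `Z(E)` and so kills `D`; hence an element central modulo `D` lands in `Z(E)`, that
is, lies in `f.ker`.

Conversely, `f.ker` must be exactly the set of elements central modulo `D`. Both sets lie in `[K,
K]`: the first by minimality of `n` (`ker_le_commutator`), the second by testing on the Heisenberg
group (`mem_commutator_of_comm_mem`). Since `[K, K] ≤ B · K₃`, with `K₃` central and killed by `f`,
only elements of `B` matter. For odd `p` these are the products `k` with exponents below `p`
(`comm_pow_eq_one`), to which the condition applies. -/

namespace Capability

/-! ### Commutators in groups of small class -/

section GroupLemmas

variable {K : Type*} [Group K]

theorem comm_mem_commutator {H L : Subgroup K} {a b : K} (ha : a ∈ H) (hb : b ∈ L) :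
    comm a b ∈ ⁅H, L⁆ := by
  rw [commutator_eq_closure_comm]
  exact Subgroup.subset_closure ⟨a, ha, b, hb, rfl⟩

theorem map_comm {L : Type*} [Group L] (f : K →* L) (a b : K) :
    f (comm a b) = comm (f a) (f b) := by
  simp [comm]

theorem comm_eq_one_iff {a b : K} : comm a b = 1 ↔ a * b = b * a := by
  unfold comm
  constructor
  · intro h
    have h' : b * a * (a⁻¹ * b⁻¹ * a * b) = b * a * 1 := by rw [h]
    simpa [mul_assoc] using h'
  · intro h
    rw [mul_assoc, h]
    group

/-- The last nontrivial term of the lower central series is central. -/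
theorem lowerCentralSeries_le_center {m : ℕ}
    (h : (⊤ : Subgroup K).lowerCentralSeries (m + 1) = ⊥) :
    (⊤ : Subgroup K).lowerCentralSeries m ≤ Subgroup.center K := by
  rw [Subgroup.lowerCentralSeries_succ, Subgroup.commutator_eq_bot_iff_le_centralizer] at h
  simpa [Subgroup.centralizer_univ] using h

/-- The commutator subgroup of a group of class at most `3` is abelian. -/
theorem commutator_commute_of_class_le_three
    (h : (⊤ : Subgroup K).lowerCentralSeries 3 = ⊥) {a b : K}
    (ha : a ∈ commutator K) (hb : b ∈ commutator K) : Commute a b := by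
  have h3 : ⁅⁅commutator K, (⊤ : Subgroup K)⁆, (⊤ : Subgroup K)⁆ = ⊥ := by
    rw [← Subgroup.top_lowerCentralSeries_one]
    exact h
  have h4 : ⁅commutator K, commutator K⁆ = ⊥ := by
    conv_lhs => enter [1]; rw [commutator_def]
    -- Three subgroups lemma for `⊤`, `⊤` and `commutator K`.
    refine Subgroup.commutator_commutator_eq_bot_of_rotate ?_ h3
    rw [Subgroup.commutator_comm ⊤]
    exact h3
  rw [Subgroup.commutator_eq_bot_iff_le_centralizer] at h4
  exact (Subgroup.mem_centralizer_iff.mp (h4 ha) b hb).symm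

/-- Moving `x` left past `c ^ t` costs `d ^ t`, so collecting `m` factors costs `0 + 1 + ⋯ + (m -
1)` copies of `d`. -/
theorem mul_pow_of_commutator_central {x c d : K} (h : c * x = x * c * d)
    (hx : Commute d x) (hc : Commute d c) (m : ℕ) :
    (x * c) ^ m = x ^ m * c ^ m * d ^ m.choose 2 := by
  have key : ∀ m : ℕ, c ^ m * x = x * c ^ m * d ^ m := by
    intro m
    induction m with
    | zero => simp
    | succ m ih =>
      have := (hc.pow_left m).eq
      calc c ^ (m + 1) * x = c ^ m * x * c * d := by rw [pow_succ, mul_assoc, h]; group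
        _ = x * c ^ m * (d ^ m * c) * d := by rw [ih]; group
        _ = x * c ^ (m + 1) * d ^ (m + 1) := by rw [this]; simp only [pow_succ, mul_assoc]
  induction m with
  | zero => simp
  | succ m ih =>
    have h1 := (hx.pow_left (m.choose 2)).eq
    have h2 := (hc.pow_left (m.choose 2 + m)).eq
    have e : (m + 1).choose 2 = m.choose 2 + m := by
      rw [Nat.choose_succ_succ' m 1, Nat.choose_one_right, add_comm]
    calc (x * c) ^ (m + 1) = x ^ m * c ^ m * (d ^ m.choose 2 * x) * c := by
          rw [pow_succ, ih]; simp only [mul_assoc]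
      _ = x ^ m * (c ^ m * x) * d ^ m.choose 2 * c := by rw [h1]; simp only [mul_assoc]
      _ = x ^ (m + 1) * c ^ m * (d ^ (m.choose 2 + m) * c) := by
          rw [key, add_comm (m.choose 2), pow_add d, pow_succ x m]; simp only [mul_assoc]
      _ = _ := by rw [h2, e]; simp only [pow_succ, mul_assoc]

/-- In class `3`, commutators with an element of odd prime order `p` have order dividing `p`. -/
theorem comm_pow_eq_one {p : ℕ} (hp : p.Prime) (hodd : Odd p)
    (h : (⊤ : Subgroup K).lowerCentralSeries 3 = ⊥) {x : K} (hx : x ^ p = 1) (y : K) :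
    comm x y ^ p = 1 := by
  have hc : comm x y ∈ (⊤ : Subgroup K).lowerCentralSeries 1 :=
    comm_mem_commutator (H := ⊤) (Subgroup.mem_top x) (Subgroup.mem_top y)
  have hd : ∀ z, Commute (comm (comm x y) x) z := fun z =>
    ((Subgroup.mem_center_iff.mp (lowerCentralSeries_le_center h
      (comm_mem_commutator hc (Subgroup.mem_top x)))) z).symm
  have hcx : comm x y * x = x * comm x y * comm (comm x y) x := by
    rw [show comm (comm x y) x = (comm x y)⁻¹ * x⁻¹ * comm x y * x from rfl]; group
  set c := comm x y with hcdef
  set d := comm c x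
  -- `x * d` is a conjugate of `x` and `d` is central; likewise `x * c` below is a conjugate of `x`.
  have hdp : d ^ p = 1 := by
    have h1 : x * d = c * x * c⁻¹ := by
      rw [hcx, mul_assoc, (hd c⁻¹).eq, mul_assoc, mul_inv_cancel_left]
    have h2 : (x * d) ^ p = 1 := by
      rw [h1, conj_pow, hx]
      simp
    rwa [((hd x).symm).mul_pow, hx, one_mul] at h2
  have h1 : x * c = y⁻¹ * x * y := by
    simp only [hcdef, comm]; group
  have h2 : (x * c) ^ p = 1 := by
    rw [h1, show y⁻¹ * x * y = y⁻¹ * x * (y⁻¹)⁻¹ by rw [inv_inv], conj_pow, hx]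
    simp
  rw [mul_pow_of_commutator_central hcx (hd x) (hd c), hx, one_mul] at h2
  -- Oddness enters here: `p` divides `p.choose 2` only when `p > 2`.
  have hp2 : 2 < p := by
    rcases hp.two_le.lt_or_eq with h | h
    · exact h
    · subst h; exact absurd hodd (by decide)
  obtain ⟨q, hq⟩ := hp.dvd_choose_self two_ne_zero hp2
  rwa [hq, pow_mul, hdp, one_pow, mul_one] at h2

/-- A normal subgroup modulo which the generators commute contains the commutator subgroup. -/
theorem commutator_le_of_generators {ι : Type*} {y : ι → K}
    (hy : Subgroup.closure (Set.range y) = ⊤) (M : Subgroup K) [M.Normal]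
    (h : ∀ i j, comm (y i) (y j) ∈ M) : commutator K ≤ M := by
  have hcl : Subgroup.closure (Set.range fun i => (y i : K ⧸ M)) = ⊤ := by
    have h1 := MonoidHom.map_closure (QuotientGroup.mk' M) (Set.range y)
    rw [hy, Subgroup.map_top_of_surjective _ (QuotientGroup.mk'_surjective M),
      ← Set.range_comp] at h1
    exact h1.symm
  have hc : ∀ a b : K ⧸ M, a * b = b * a := by
    have hle : (⊤ : Subgroup (K ⧸ M)) ≤ Subgroup.centralizer (⊤ : Subgroup (K ⧸ M)) := by
      conv_lhs => rw [← hcl]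
      rw [Subgroup.closure_le, ← hcl, Subgroup.centralizer_closure]
      rintro _ ⟨i, rfl⟩
      rw [SetLike.mem_coe, Subgroup.mem_centralizer_iff]
      rintro _ ⟨j, rfl⟩
      rw [← comm_eq_one_iff]
      have := map_comm (QuotientGroup.mk' M) (y j) (y i)
      simp only [QuotientGroup.mk'_apply] at this
      rw [← this, QuotientGroup.eq_one_iff]
      exact h j i
    intro a b
    exact (Subgroup.mem_centralizer_iff.mp (hle (Subgroup.mem_top a)) b (Subgroup.mem_top b)).symm
  rw [commutator_def, commutator_eq_closure_comm, Subgroup.closure_le]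
  rintro _ ⟨a, -, b, -, rfl⟩
  rw [SetLike.mem_coe, ← QuotientGroup.eq_one_iff]
  have := map_comm (QuotientGroup.mk' M) a b
  simp only [QuotientGroup.mk'_apply] at this
  rw [this, comm_eq_one_iff]
  exact hc _ _

/-- A subgroup generating a group of class at most `2` modulo the commutator subgroup is the whole
group. -/
theorem eq_top_of_sup_commutator_eq_top
    (h : (⊤ : Subgroup K).lowerCentralSeries 2 = ⊥) {M : Subgroup K}
    (hM : M ⊔ commutator K = ⊤) : M = ⊤ := by
  have hZ : commutator K ≤ Subgroup.center K := by
    rw [← Subgroup.top_lowerCentralSeries_one]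
    exact lowerCentralSeries_le_center h
  -- Two elements are members of `M` up to central factors, so their commutator is one of members of
  -- `M`.
  have key : commutator K ≤ M := by
    rw [commutator_def, Subgroup.commutator_le]
    intro a _ b _
    obtain ⟨s, hs, z, hz, rfl⟩ := Subgroup.mem_sup_of_normal_right.mp (hM.symm ▸ Subgroup.mem_top a : a ∈ M ⊔ commutator K)
    obtain ⟨t, ht, w, hw, rfl⟩ := Subgroup.mem_sup_of_normal_right.mp (hM.symm ▸ Subgroup.mem_top b : b ∈ M ⊔ commutator K)
    have hz' := Subgroup.mem_center_iff.mp (hZ hz)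
    have hw' := Subgroup.mem_center_iff.mp (hZ hw)
    have : s * z * (t * w) * (s * z)⁻¹ * (t * w)⁻¹ = s * t * s⁻¹ * t⁻¹ := by
      calc s * z * (t * w) * (s * z)⁻¹ * (t * w)⁻¹
          = s * (z * (t * w)) * (z⁻¹ * s⁻¹) * (w⁻¹ * t⁻¹) := by group
        _ = s * t * (w * s⁻¹) * (w⁻¹ * t⁻¹) := by rw [← hz' (t * w)]; group
        _ = s * t * s⁻¹ * t⁻¹ := by rw [← hw' s⁻¹]; group
    rw [commutatorElement_def, this]
    exact mul_mem (mul_mem (mul_mem hs ht) (inv_mem hs)) (inv_mem ht)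
  rwa [sup_eq_left.mpr key] at hM

/-- Every element of a group generated by a finite family is a product of powers of the generators
modulo the commutator subgroup. -/
theorem exists_abelianization_eq_prod {n : ℕ} {y : Fin n → K}
    (hy : Subgroup.closure (Set.range y) = ⊤) (k : K) :
    ∃ a : Fin n → ℤ, Abelianization.of k = ∏ i, Abelianization.of (y i) ^ a i := by
  have hk : k ∈ Subgroup.closure (Set.range y) := hy ▸ Subgroup.mem_top k
  induction hk using Subgroup.closure_induction with
  | mem x hx =>
    obtain ⟨i, rfl⟩ := hx
    refine ⟨Pi.single i 1, ?_⟩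
    rw [Finset.prod_eq_single i] <;> simp +contextual
  | one => exact ⟨0, by simp⟩
  | mul a b _ _ ha hb =>
    obtain ⟨s, hs⟩ := ha
    obtain ⟨t, ht⟩ := hb
    exact ⟨s + t, by simp [hs, ht, zpow_add, Finset.prod_mul_distrib]⟩
  | inv a _ ha =>
    obtain ⟨s, hs⟩ := ha
    exact ⟨-s, by simp [hs]⟩

/-- Lets one choice of exponents be read off in any commutative image. -/
theorem map_eq_prod_of_abelianization_eq {n : ℕ} {y : Fin n → K} {k : K} {a : Fin n → ℤ}
    (h : Abelianization.of k = ∏ i, Abelianization.of (y i) ^ a i)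
    {Q : Type*} [CommGroup Q] (f : K →* Q) : f k = ∏ i, f (y i) ^ a i := by
  simpa using congrArg (Abelianization.lift f) h

/-- A product of powers of elements of order dividing `p` with exponents divisible by `p` lies in
the commutator subgroup. -/
theorem mem_commutator_of_dvd {p n : ℕ} {y : Fin n → K} (hyp : ∀ i, y i ^ p = 1)
    {k : K} {a : Fin n → ℤ} (h : Abelianization.of k = ∏ i, Abelianization.of (y i) ^ a i)
    (ha : ∀ i, (p : ℤ) ∣ a i) : k ∈ commutator K := by
  rw [← Abelianization.ker_of, MonoidHom.mem_ker, h]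
  refine Finset.prod_eq_one fun i _ => ?_
  obtain ⟨b, hb⟩ := ha i
  rw [hb, zpow_mul, zpow_natCast, ← map_pow, hyp, map_one, one_zpow]

end GroupLemmas

/-! ### Ordered products of commuting elements -/

section ListProducts

variable {M : Type*} [Group M] {ι : Type*} {c : ι → M}

theorem list_prod_pow_add (hc : ∀ i j, Commute (c i) (c j)) (l : List ι) (a b : ι → ℕ) :
    (l.map fun t => c t ^ (a t + b t)).prod =
      (l.map fun t => c t ^ a t).prod * (l.map fun t => c t ^ b t).prod := by
  induction l with
  | nil => simp
  | cons s l ih =>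
    have : Commute (c s ^ b s) (l.map fun t => c t ^ a t).prod := by
      refine Commute.list_prod_right _ _ fun z hz => ?_
      obtain ⟨t, -, rfl⟩ := List.mem_map.mp hz
      exact (hc s t).pow_pow _ _
    rw [List.map_cons, List.prod_cons, ih, pow_add, List.map_cons, List.prod_cons, List.map_cons,
      List.prod_cons, mul_assoc, mul_assoc, ← mul_assoc (c s ^ b s), this.eq, mul_assoc]

/-- In the group generated by commuting elements of order dividing `p`, every element is an
ordered product of powers of the generators with exponents below `p`. -/
theorem exists_list_prod_of_mem_closure [DecidableEq ι] {p : ℕ} (hp : 0 < p)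
    (hc : ∀ i j, Commute (c i) (c j)) (hcp : ∀ i, c i ^ p = 1) {l : List ι} (hl : l.Nodup)
    {k : M} (hk : k ∈ Subgroup.closure {z | ∃ t ∈ l, z = c t}) :
    ∃ a : ι → ℕ, (∀ t, a t < p) ∧ k = (l.map fun t => c t ^ a t).prod := by
  suffices h : ∃ a : ι → ℕ, k = (l.map fun t => c t ^ a t).prod by
    obtain ⟨a, rfl⟩ := h
    refine ⟨fun t => a t % p, fun t => Nat.mod_lt _ hp, ?_⟩
    congr 1
    exact List.map_congr_left fun t _ => pow_eq_pow_mod _ (hcp t)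
  induction hk using Subgroup.closure_induction with
  | mem x hx =>
    obtain ⟨s, hs, rfl⟩ := hx
    refine ⟨Pi.single s 1, ?_⟩
    rw [List.prod_map_eq_pow_single s]
    · simp [List.count_eq_one_of_mem hl hs]
    · intro t ht _
      simp [Pi.single_eq_of_ne ht]
  | one => exact ⟨0, by simp⟩
  | mul x y _ _ hx hy =>
    obtain ⟨a, rfl⟩ := hx
    obtain ⟨b, rfl⟩ := hy
    exact ⟨fun t => a t + b t, (list_prod_pow_add hc l a b).symm⟩
  | inv x _ hx =>
    obtain ⟨a, rfl⟩ := hx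
    -- Exponents are natural numbers, so `-1` is replaced by `p - 1`.
    refine ⟨fun t => (p - 1) * a t, ?_⟩
    rw [inv_eq_iff_mul_eq_one, ← list_prod_pow_add hc]
    refine List.prod_eq_one fun z hz => ?_
    obtain ⟨t, -, rfl⟩ := List.mem_map.mp hz
    have : a t + (p - 1) * a t = p * a t := by
      obtain ⟨q, rfl⟩ : ∃ q, p = q + 1 := ⟨p - 1, by omega⟩
      simp only [Nat.add_sub_cancel]
      ring
    rw [this, pow_mul, hcp, one_pow]

end ListProducts

end Capability

namespace Capability

/-! ### Adjusting a witness of capability -/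

section CentralExtension

/-- A capable group `G` is the quotient by its center of a group in which given elements of `G` of
order dividing `p` lift to elements of order dividing `p`. -/
theorem IsCapable.exists_lift {p n : ℕ} (hp : 0 < p) {G : Type u} [Group G] (hG : IsCapable G)
    (g : Fin n → G) (hg : ∀ i, g i ^ p = 1) :
    ∃ (E : Type u) (_ : Group E) (π : E →* G) (e : Fin n → E), Function.Surjective π ∧
      π.ker = Subgroup.center E ∧ (∀ i, π (e i) = g i) ∧ ∀ i, e i ^ p = 1 := by
  obtain ⟨H, _, ⟨φ⟩⟩ := hG
  choose h hh using fun i => QuotientGroup.mk_surjective (φ (g i))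
  have hz : ∀ i, h i ^ p ∈ Subgroup.center H := fun i => by
    rw [← QuotientGroup.eq_one_iff, QuotientGroup.mk_pow, hh, ← map_pow, hg, map_one]
  let _ : CommGroup (Subgroup.center H) :=
    { mul_comm := fun s t => Subtype.ext (Subgroup.mem_center_iff.mp t.2 s) }
  -- The quotient of `H × ℤⁿ` by the elements `(z i, -p εᵢ)` adjoins central `p`-th roots of the `z
  -- i`; dividing `h i` by its root gives the lift of order dividing `p`.
  let z : Fin n → Subgroup.center H := fun i => ⟨h i ^ p, hz i⟩
  let w : Multiplicative (Fin n → ℤ) →* Subgroup.center H :=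
    MonoidHom.mk' (fun a => ∏ i, z i ^ (a.toAdd i)) fun a b => by
      simp [zpow_add, Finset.prod_mul_distrib]
  let r : Multiplicative (Fin n → ℤ) →* H × Multiplicative (Fin n → ℤ) :=
    ((Subgroup.center H).subtype.comp w).prod (zpowGroupHom (-(p : ℤ)))
  have hr : r.range ≤ Subgroup.center (H × Multiplicative (Fin n → ℤ)) := by
    rintro _ ⟨a, rfl⟩
    rw [Subgroup.mem_center_iff]
    rintro ⟨u, m⟩
    exact Prod.ext (Subgroup.mem_center_iff.mp (w a).2 u) (mul_comm _ _)
  have hn : r.range.Normal := ⟨fun d hd v => by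
    rwa [Subgroup.mem_center_iff.mp (hr hd) v, mul_inv_cancel_right]⟩
  let ψ : H × Multiplicative (Fin n → ℤ) →* G :=
    φ.symm.toMonoidHom.comp ((QuotientGroup.mk' (Subgroup.center H)).comp (MonoidHom.fst _ _))
  have hψ : ∀ d, ψ d = 1 ↔ d.1 ∈ Subgroup.center H := fun d => by
    simp [ψ]
  let π : (H × Multiplicative (Fin n → ℤ)) ⧸ r.range →* G := QuotientGroup.lift _ ψ (by
    rintro _ ⟨a, rfl⟩
    exact (hψ _).mpr (w a).2)
  refine ⟨_, inferInstance, π,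
    fun i => QuotientGroup.mk' r.range (h i, Multiplicative.ofAdd (-Pi.single i 1)), ?_, ?_, ?_, ?_⟩
  · intro x
    obtain ⟨u, hu⟩ := QuotientGroup.mk_surjective (φ x)
    exact ⟨QuotientGroup.mk' r.range (u, 1), by simp [π, ψ, hu]⟩
  · ext d
    obtain ⟨⟨u, m⟩, rfl⟩ := QuotientGroup.mk_surjective d
    rw [MonoidHom.mem_ker]
    change ψ (u, m) = 1 ↔ _
    rw [hψ, Subgroup.mem_center_iff, Subgroup.mem_center_iff]
    constructor
    · intro hu d
      obtain ⟨⟨v, m'⟩, rfl⟩ := QuotientGroup.mk_surjective d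
      rw [← QuotientGroup.mk_mul, ← QuotientGroup.mk_mul]
      exact congrArg _ (Prod.ext (hu v) (mul_comm _ _))
    · intro hd v
      have h1 := hd (QuotientGroup.mk (v, 1))
      rw [← QuotientGroup.mk_mul, ← QuotientGroup.mk_mul, QuotientGroup.eq] at h1
      obtain ⟨a, ha⟩ := h1
      -- The second coordinate `-p a` vanishes and `ℤⁿ` is torsion-free, so no new central elements
      -- appear in the quotient.
      have h2 : a = 1 := by
        have h3 := congrArg Prod.snd ha
        have h4 : a ^ (-(p : ℤ)) = 1 := by
          simpa [r] using h3
        have h5 : (-(p : ℤ)) • a.toAdd = 0 := h4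
        have h6 := (smul_eq_zero.mp h5).resolve_left (by omega)
        exact h6
      rw [h2, map_one] at ha
      have h3 := congrArg Prod.fst ha
      simp only [Prod.fst_one, Prod.fst_mul, Prod.fst_inv] at h3
      exact inv_mul_eq_one.mp h3.symm
  · intro i
    change ψ _ = _
    simp [ψ, hh]
  · intro i
    rw [← map_pow, QuotientGroup.mk'_apply, QuotientGroup.eq_one_iff]
    refine ⟨Multiplicative.ofAdd (Pi.single i 1), ?_⟩
    have hw : w (Multiplicative.ofAdd (Pi.single i 1)) = z i := by
      change ∏ j, z j ^ (Pi.single i 1 : Fin n → ℤ) j = z i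
      rw [Finset.prod_eq_single i] <;> simp +contextual
    refine Prod.ext ?_ ?_
    · change ((w _ : Subgroup.center H) : H) = h i ^ p
      rw [hw]
    · change Multiplicative.ofAdd (-(p : ℤ) • (Pi.single i 1 : Fin n → ℤ)) =
        Multiplicative.ofAdd (p • -(Pi.single i 1 : Fin n → ℤ))
      simp

end CentralExtension

/-! ### The Heisenberg group as a test group -/

section Heisenberg

/-- The group of upper unitriangular `3 × 3` matrices over `R`. -/
@[ext] structure Heisenberg (R : Type*) where
  a : R
  b : R
  c : R

namespace Heisenberg

variable {R : Type*} [CommRing R]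

instance : Mul (Heisenberg R) := ⟨fun s t => ⟨s.a + t.a, s.b + t.b, s.c + t.c + s.a * t.b⟩⟩
instance : One (Heisenberg R) := ⟨⟨0, 0, 0⟩⟩
instance : Inv (Heisenberg R) := ⟨fun s => ⟨-s.a, -s.b, -s.c + s.a * s.b⟩⟩

@[simp] theorem mul_a (s t : Heisenberg R) : (s * t).a = s.a + t.a := rfl
@[simp] theorem mul_b (s t : Heisenberg R) : (s * t).b = s.b + t.b := rfl
@[simp] theorem mul_c (s t : Heisenberg R) : (s * t).c = s.c + t.c + s.a * t.b := rfl
@[simp] theorem one_a : (1 : Heisenberg R).a = 0 := rfl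
@[simp] theorem one_b : (1 : Heisenberg R).b = 0 := rfl
@[simp] theorem one_c : (1 : Heisenberg R).c = 0 := rfl
@[simp] theorem inv_a (s : Heisenberg R) : s⁻¹.a = -s.a := rfl
@[simp] theorem inv_b (s : Heisenberg R) : s⁻¹.b = -s.b := rfl
@[simp] theorem inv_c (s : Heisenberg R) : s⁻¹.c = -s.c + s.a * s.b := rfl

instance : Group (Heisenberg R) := Group.ofLeftAxioms
  (fun s t r => by ext <;> simp <;> ring)
  (fun s => by ext <;> simp)
  (fun s => by ext <;> simp)

/-- The first superdiagonal entry, as a homomorphism. -/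
def aHom : Heisenberg R →* Multiplicative R where
  toFun s := Multiplicative.ofAdd s.a
  map_one' := rfl
  map_mul' _ _ := rfl

/-- All cross terms are multiples of `s.a * s.b`. Over `ZMod p` it bounds the orders of the two
standard generators. -/
theorem pow_of_eq_zero {s : Heisenberg R} (h : s.a * s.b = 0) (m : ℕ) :
    s ^ m = ⟨m * s.a, m * s.b, m * s.c⟩ := by
  induction m with
  | zero => ext <;> simp
  | succ m ih =>
    rw [pow_succ, ih]
    ext <;> simp [add_mul, mul_assoc, h]

theorem comm_mul_eq_mul_comm (s t r : Heisenberg R) :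
    comm s t * r = r * comm s t := by
  ext
  · simp [comm]
  · simp [comm]
  · simp [comm]; ring

theorem lowerCentralSeries_two :
    (⊤ : Subgroup (Heisenberg R)).lowerCentralSeries 2 = ⊥ := by
  rw [Subgroup.lowerCentralSeries_succ, Subgroup.commutator_eq_bot_iff_le_centralizer,
    Subgroup.lowerCentralSeries_succ, Subgroup.lowerCentralSeries_zero,
    commutator_eq_closure_comm, Subgroup.closure_le]
  rintro _ ⟨s, -, t, -, rfl⟩
  rw [SetLike.mem_coe, Subgroup.mem_centralizer_iff]
  intro r _
  exact (comm_mul_eq_mul_comm s t r).symm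

end Heisenberg

end Heisenberg

/-! ### Change of universe -/

section Countable

/-- A group with a countable witness for capability in any universe is capable. -/
theorem IsCapable.of_countable {G : Type u} [Group G] {C : Type v} [Group C] [Countable C]
    (e : G ≃* C ⧸ Subgroup.center C) : IsCapable G := by
  let s : C ≃* Shrink.{u} C := Shrink.mulEquiv.symm
  have hs : (Subgroup.center C).map (s : C →* Shrink.{u} C) = Subgroup.center _ := by
    ext d
    simp only [Subgroup.mem_map, Subgroup.mem_center_iff]
    constructor
    · rintro ⟨c, hc, rfl⟩ b
      obtain ⟨b, rfl⟩ := s.surjective b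
      simpa using congrArg s (hc b)
    · intro hd
      obtain ⟨c, rfl⟩ := s.surjective d
      refine ⟨c, fun b => s.injective ?_, rfl⟩
      simpa using hd (s b)
  exact ⟨Shrink.{u} C, inferInstance, ⟨e.trans (QuotientGroup.congr _ _ s hs)⟩⟩

theorem countable_of_closure_finite {K : Type v} [Group K] {n : ℕ} {y : Fin n → K}
    (hy : Subgroup.closure (Set.range y) = ⊤) : Countable K := by
  have hs : Function.Surjective (FreeGroup.lift y) := by
    rw [← MonoidHom.range_eq_top, FreeGroup.range_lift_eq_closure, hy]
  have : Countable (FreeGroup (Fin n)) := by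
    unfold FreeGroup
    infer_instance
  exact hs.countable

end Countable

end Capability

namespace Capability

/-! ### The kernel of `K → G` and centrality modulo `[N, K]` -/

theorem mem_center_iff_of_closure_eq_top {ι K : Type*} [Group K] {y : ι → K}
    (hy : Subgroup.closure (Set.range y) = ⊤) {k : K} :
    k ∈ Subgroup.center K ↔ ∀ i, comm k (y i) = 1 := by
  rw [← Subgroup.centralizer_univ, ← Subgroup.coe_top, ← hy, Subgroup.centralizer_closure,
    Subgroup.mem_centralizer_iff]
  simp only [Set.forall_mem_range, comm_eq_one_iff, eq_comm]

theorem comm_mul_of_mem_center {K : Type*} [Group K] (b y : K) {z : K}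
    (hz : z ∈ Subgroup.center K) : comm (b * z) y = comm b y := by
  rw [Subgroup.mem_center_iff] at hz
  unfold comm
  rw [mul_inv_rev, show z⁻¹ * b⁻¹ * y⁻¹ * (b * z) * y = z⁻¹ * (b⁻¹ * y⁻¹ * b * z) * y by group,
    hz]
  group

section Criterion

variable {K : Type v} [Group K] {n : ℕ} {y : Fin n → K} {G : Type u} [Group G] {g : Fin n → G}

/-- If `g` is a generating family of minimal length of a group of class at most `2` and exponent
`p`, the relations among its members hold in the commutator subgroup. -/
theorem ker_le_commutator {p : ℕ} (hp : p.Prime)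
    (hclass : (⊤ : Subgroup G).lowerCentralSeries 2 = ⊥) (hgp : ∀ i, g i ^ p = 1)
    (hgen : Subgroup.closure (Set.range g) = ⊤)
    (hmin : ∀ (m : ℕ) (h : Fin m → G), Subgroup.closure (Set.range h) = ⊤ → n ≤ m)
    (hy : Subgroup.closure (Set.range y) = ⊤) (hyp : ∀ i, y i ^ p = 1)
    (f : K →* G) (hf : ∀ i, f (y i) = g i) : f.ker ≤ commutator K := by
  intro k hk
  obtain ⟨a, ha⟩ := exists_abelianization_eq_prod hy k
  refine mem_commutator_of_dvd hyp ha fun i => ?_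
  -- Otherwise the relation `f k = 1` expresses `g i` through the other generators modulo
  -- commutators, and these `n - 1` elements generate `G`.
  by_contra hi
  obtain ⟨m, rfl⟩ : ∃ m, n = m + 1 := ⟨n - 1, by have := i.pos; omega⟩
  let M := Subgroup.closure (Set.range fun j => g (i.succAbove j))
  have hM : ∀ j, g (i.succAbove j) ∈ M := fun j => Subgroup.subset_closure ⟨j, rfl⟩
  suffices h : M = ⊤ by
    have := hmin m _ h
    omega
  refine eq_top_of_sup_commutator_eq_top hclass ?_
  rw [eq_top_iff, ← hgen, Subgroup.closure_le]
  rintro _ ⟨j, rfl⟩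
  rcases Fin.eq_self_or_eq_succAbove i j with rfl | ⟨j, rfl⟩
  · rw [SetLike.mem_coe, ← Abelianization.ker_of, ← Subgroup.comap_map_eq, Subgroup.mem_comap]
    have h1 := map_eq_prod_of_abelianization_eq ha (Abelianization.of.comp f)
    simp only [MonoidHom.comp_apply, MonoidHom.mem_ker.mp hk, map_one, hf,
      Fin.prod_univ_succAbove _ j] at h1
    have h2 : Abelianization.of (g j) ^ a j ∈ M.map Abelianization.of := by
      rw [eq_inv_of_mul_eq_one_left h1.symm]
      exact inv_mem (Subgroup.prod_mem _ fun t _ =>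
        Subgroup.zpow_mem _ (Subgroup.mem_map_of_mem _ (hM t)) _)
    -- Bézout inverts the exponent modulo `p`.
    obtain ⟨u, w, huw⟩ := (Nat.prime_iff_prime_int.mp hp).coprime_iff_not_dvd.mpr hi
    have h3 : Abelianization.of (g j) = (Abelianization.of (g j) ^ a j) ^ w := by
      rw [← zpow_mul]
      conv_lhs => rw [← zpow_one (Abelianization.of (g j)), ← huw, zpow_add, mul_comm u,
        zpow_mul _ (p : ℤ), zpow_natCast, ← map_pow, hgp, map_one, one_zpow, one_mul, mul_comm]
    rw [h3]
    exact Subgroup.zpow_mem _ h2 _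
  · exact Subgroup.mem_sup_left (hM j)

/-- If all choices of elements of order dividing `p` in the Heisenberg group over `ZMod p` are
images of the generators, elements that are central modulo the third term of the lower central
series lie in the commutator subgroup. -/
theorem mem_commutator_of_comm_mem {p : ℕ} (hn : 1 < n)
    (hy : Subgroup.closure (Set.range y) = ⊤) (hyp : ∀ i, y i ^ p = 1)
    (huniv : ∀ s : Fin n → Heisenberg (ZMod p), (∀ i, s i ^ p = 1) →
      ∃ φ : K →* Heisenberg (ZMod p), ∀ i, φ (y i) = s i)
    {k : K} (hk : ∀ i, comm k (y i) ∈ (⊤ : Subgroup K).lowerCentralSeries 2) :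
    k ∈ commutator K := by
  obtain ⟨a, ha⟩ := exists_abelianization_eq_prod hy k
  refine mem_commutator_of_dvd hyp ha fun i => ?_
  have : Nontrivial (Fin n) := Fin.nontrivial_iff_two_le.mpr hn
  obtain ⟨j, hj⟩ := exists_ne i
  -- With `y i`, `y j` sent to the standard generators, commuting with the image of `y j` forces `(φ
  -- k).a = 0`, and this entry is `a i` modulo `p`.
  obtain ⟨φ, hφ⟩ := huniv
    (fun t => if t = i then ⟨1, 0, 0⟩ else if t = j then ⟨0, 1, 0⟩ else 1) (by
      intro t
      split_ifs
      · rw [Heisenberg.pow_of_eq_zero (by simp)]; ext <;> simp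
      · rw [Heisenberg.pow_of_eq_zero (by simp)]; ext <;> simp
      · exact one_pow _)
  have h1 : φ (comm k (y j)) = 1 := by
    have h := Subgroup.mem_map_of_mem φ (hk j)
    rw [Subgroup.map_lowerCentralSeries] at h
    have h' : _ ∈ (⊤ : Subgroup (Heisenberg (ZMod p))).lowerCentralSeries 2 :=
      Subgroup.lowerCentralSeries_mono 2 le_top h
    rwa [Heisenberg.lowerCentralSeries_two, Subgroup.mem_bot] at h'
  rw [map_comm, comm_eq_one_iff, hφ, if_neg hj, if_pos rfl] at h1
  have h2 : (φ k).a = 0 := by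
    simpa using congrArg Heisenberg.c h1
  have h3 := map_eq_prod_of_abelianization_eq ha (Heisenberg.aHom.comp φ)
  rw [Finset.prod_eq_single i] at h3
  · have h4 : (φ k).a = a i • (φ (y i)).a := h3
    rw [h2, hφ, if_pos rfl, zsmul_one] at h4
    exact (ZMod.intCast_zmod_eq_zero_iff_dvd _ _).mp h4.symm
  · intro t _ hti
    simp only [MonoidHom.comp_apply, hφ, if_neg hti]
    split_ifs
    · exact one_zpow _
    · rw [map_one, one_zpow]
  · simp

/-- The commutator subgroup is generated by the commutators of the generators modulo the third term
of the lower central series. -/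
theorem commutator_le_sup_lowerCentralSeries (hy : Subgroup.closure (Set.range y) = ⊤) :
    commutator K ≤ Subgroup.closure {c | ∃ i j, i < j ∧ c = comm (y j) (y i)} ⊔
      (⊤ : Subgroup K).lowerCentralSeries 2 := by
  set B := Subgroup.closure {c | ∃ i j, i < j ∧ c = comm (y j) (y i)}
  have hle : B ⊔ (⊤ : Subgroup K).lowerCentralSeries 2 ≤
      (⊤ : Subgroup K).lowerCentralSeries 1 := by
    refine sup_le ?_ (Subgroup.lowerCentralSeries_antitone _ one_le_two)
    rw [Subgroup.closure_le]
    rintro _ ⟨i, j, -, rfl⟩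
    exact comm_mem_commutator (H := ⊤) (Subgroup.mem_top _) (Subgroup.mem_top _)
  -- Conjugation changes an element of `[K, K]` only by a factor in `K₃`.
  have hnorm : (B ⊔ (⊤ : Subgroup K).lowerCentralSeries 2).Normal := by
    refine ⟨fun h hh t => ?_⟩
    have h1 : comm h⁻¹ t⁻¹ ∈ (⊤ : Subgroup K).lowerCentralSeries 2 :=
      comm_mem_commutator (inv_mem (hle hh)) (Subgroup.mem_top _)
    have h2 : t * h * t⁻¹ = (comm h⁻¹ t⁻¹)⁻¹ * h := by
      unfold comm
      group
    rw [h2]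
    exact mul_mem (inv_mem (Subgroup.mem_sup_right h1)) hh
  refine commutator_le_of_generators hy _ fun i j => ?_
  have hB : ∀ i j, i < j → comm (y j) (y i) ∈ B ⊔ (⊤ : Subgroup K).lowerCentralSeries 2 :=
    fun i j hij => Subgroup.mem_sup_left (Subgroup.subset_closure ⟨i, j, hij, rfl⟩)
  rcases lt_trichotomy i j with h | rfl | h
  · have : comm (y i) (y j) = (comm (y j) (y i))⁻¹ := by
      unfold comm
      group
    rw [this]
    exact inv_mem (hB i j h)
  · rw [comm_eq_one_iff.mpr rfl]
    exact one_mem _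
  · exact hB j i h

/-- If the elements of the basic commutator subgroup that are central modulo `[N, K]` lie in `N`,
then the elements of `K` that are central modulo `[N, K]` are those of the kernel of `K → G`. -/
theorem mem_ker_iff_forall_comm_mem {B : Subgroup K}
    (hB : B = Subgroup.closure {c | ∃ i j, i < j ∧ c = comm (y j) (y i)})
    (hK : (⊤ : Subgroup K).lowerCentralSeries 3 = ⊥)
    (hclass : (⊤ : Subgroup G).lowerCentralSeries 2 = ⊥)
    (hy : Subgroup.closure (Set.range y) = ⊤) (f : K →* G) (hker : f.ker ≤ commutator K)
    (hcomm : ∀ k, (∀ i, comm k (y i) ∈ (⊤ : Subgroup K).lowerCentralSeries 2) → k ∈ commutator K)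
    (hcond : ∀ b ∈ B, (∀ i, comm b (y i) ∈ ⁅B ⊓ f.ker, (⊤ : Subgroup K)⁆) → b ∈ f.ker) (k : K) :
    k ∈ f.ker ↔ ∀ i, comm k (y i) ∈ ⁅B ⊓ f.ker, (⊤ : Subgroup K)⁆ := by
  -- The `K₃` part is central, because `K` has class at most 3, and dies in `G`, which has class at
  -- most 2.
  have hdec : ∀ k ∈ commutator K, ∃ b ∈ B, (f k = f b) ∧ ∀ t, comm k t = comm b t := by
    intro k hk
    have h := commutator_le_sup_lowerCentralSeries hy hk
    rw [← hB] at h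
    obtain ⟨b, hb, z, hz, rfl⟩ := Subgroup.mem_sup_of_normal_right.mp h
    refine ⟨b, hb, ?_, fun t => comm_mul_of_mem_center b t (lowerCentralSeries_le_center hK hz)⟩
    have h1 := Subgroup.mem_map_of_mem f hz
    rw [Subgroup.map_lowerCentralSeries] at h1
    have h2 : _ ∈ (⊤ : Subgroup G).lowerCentralSeries 2 :=
      Subgroup.lowerCentralSeries_mono 2 le_top h1
    rw [hclass, Subgroup.mem_bot] at h2
    rw [map_mul, h2, mul_one]
  constructor
  · intro hk i
    obtain ⟨b, hb, hf, hc⟩ := hdec k (hker hk)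
    rw [hc]
    exact comm_mem_commutator ⟨hb, hf.symm.trans hk⟩ (Subgroup.mem_top _)
  · intro hk
    have hle : ⁅B ⊓ f.ker, (⊤ : Subgroup K)⁆ ≤ (⊤ : Subgroup K).lowerCentralSeries 2 := by
      refine Subgroup.commutator_mono (inf_le_right.trans ?_) le_rfl
      rw [Subgroup.top_lowerCentralSeries_one]
      exact hker
    obtain ⟨b, hb, hf, hc⟩ := hdec k (hcomm k fun i => hle (hk i))
    rw [MonoidHom.mem_ker, hf]
    exact hcond b hb fun i => hc (y i) ▸ hk i

/-- If the kernel of `f : K → G` consists of the elements that are central modulo `D`, then `f`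
induces an isomorphism of `G` with the central quotient of `K ⧸ D`. -/
theorem nonempty_mulEquiv_quotient_center {D : Subgroup K} [D.Normal]
    (hy : Subgroup.closure (Set.range y) = ⊤) (f : K →* G) (hf : Function.Surjective f)
    (hD : D ≤ f.ker) (h : ∀ k, k ∈ f.ker ↔ ∀ i, comm k (y i) ∈ D) :
    Nonempty (G ≃* (K ⧸ D) ⧸ Subgroup.center (K ⧸ D)) := by
  let ρ : K ⧸ D →* G := QuotientGroup.lift D f hD
  have hρ : Function.Surjective ρ := QuotientGroup.lift_surjective_of_surjective D f hf hD
  have hcl : Subgroup.closure (Set.range fun i => QuotientGroup.mk' D (y i)) = ⊤ := by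
    have h1 := MonoidHom.map_closure (QuotientGroup.mk' D) (Set.range y)
    rw [hy, Subgroup.map_top_of_surjective _ (QuotientGroup.mk'_surjective D),
      ← Set.range_comp] at h1
    exact h1.symm
  have hker : ρ.ker = Subgroup.center (K ⧸ D) := by
    ext d
    obtain ⟨k, rfl⟩ := QuotientGroup.mk'_surjective D d
    rw [mem_center_iff_of_closure_eq_top hcl]
    have hc : ∀ i, comm (QuotientGroup.mk' D k) (QuotientGroup.mk' D (y i)) = 1 ↔
        comm k (y i) ∈ D := fun i => by
      rw [← map_comm, QuotientGroup.mk'_apply, QuotientGroup.eq_one_iff]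
    simp only [hc]
    exact h k
  exact ⟨(QuotientGroup.quotientKerEquivOfSurjective ρ hρ).symm.trans
    (QuotientGroup.quotientMulEquivOfEq hker)⟩

/-- If `G` is capable and `K → G` is a homomorphism from a group in which elements of order
dividing `p` can be prescribed as images of the generators, then the elements of `K` that are
central modulo `[N, K]`, where `N` is in the kernel, belong to the kernel. -/
theorem IsCapable.mem_ker_of_forall_comm_mem {p : ℕ} (hp : 0 < p) (hG : IsCapable G)
    (hclass : (⊤ : Subgroup G).lowerCentralSeries 2 = ⊥) (hgp : ∀ i, g i ^ p = 1)
    (hgen : Subgroup.closure (Set.range g) = ⊤)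
    (hy : Subgroup.closure (Set.range y) = ⊤)
    (huniv : ∀ (E : Type u) [Group E] (e : Fin n → E), (∀ i, e i ^ p = 1) →
      (⊤ : Subgroup E).lowerCentralSeries 3 = ⊥ → ∃ φ : K →* E, ∀ i, φ (y i) = e i)
    (f : K →* G) (hf : ∀ i, f (y i) = g i) {N : Subgroup K} (hN : N ≤ f.ker) {k : K}
    (hk : ∀ i, comm k (y i) ∈ ⁅N, (⊤ : Subgroup K)⁆) : k ∈ f.ker := by
  obtain ⟨E, _, π, e, hπ, hker, he, hep⟩ := hG.exists_lift hp g hgp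
  have hE : (⊤ : Subgroup E).lowerCentralSeries 3 = ⊥ := by
    have h1 : (⊤ : Subgroup E).lowerCentralSeries 2 ≤ Subgroup.center E := by
      rw [← hker, ← Subgroup.map_eq_bot_iff, Subgroup.map_lowerCentralSeries,
        Subgroup.map_top_of_surjective _ hπ, hclass]
    rw [Subgroup.lowerCentralSeries_succ, Subgroup.commutator_eq_bot_iff_le_centralizer]
    simpa [Subgroup.centralizer_univ] using h1
  obtain ⟨φ, hφ⟩ := huniv E e hep hE
  have hπφ : π.comp φ = f := by
    refine MonoidHom.eq_of_eqOn_dense hy ?_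
    rintro _ ⟨i, rfl⟩
    simp [hφ, he, hf]
  have hNφ : ⁅N, (⊤ : Subgroup K)⁆ ≤ φ.ker := by
    rw [← Subgroup.map_eq_bot_iff, Subgroup.map_commutator,
      Subgroup.commutator_eq_bot_iff_le_centralizer]
    refine le_trans ?_ (Subgroup.center_le_centralizer _)
    rw [← hker, Subgroup.map_le_iff_le_comap, MonoidHom.comap_ker, hπφ]
    exact hN
  have hcom : ∀ i, comm (φ k) (e i) = 1 := fun i => by
    rw [← hφ, ← map_comm]
    exact hNφ (hk i)
  -- The `e i` need not generate `E`, but together with the center they do, since their images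
  -- generate `G`.
  have hZ : φ k ∈ Subgroup.center E := by
    have h1 : Subgroup.closure (Set.range e) ≤ Subgroup.centralizer {φ k} := by
      rw [Subgroup.closure_le]
      rintro _ ⟨i, rfl⟩
      rw [SetLike.mem_coe, Subgroup.mem_centralizer_singleton_iff]
      exact (comm_eq_one_iff.mp (hcom i)).symm
    have h2 : (Subgroup.closure (Set.range e)).map π = ⊤ := by
      rw [MonoidHom.map_closure, ← Set.range_comp, ← hgen]
      congr 2
      exact funext he
    rw [Subgroup.mem_center_iff]
    intro b
    obtain ⟨c, hc, hcb⟩ := Subgroup.mem_map.mp (h2.symm ▸ Subgroup.mem_top (π b) :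
      π b ∈ (Subgroup.closure (Set.range e)).map π)
    have h3 : c⁻¹ * b ∈ Subgroup.center E := by
      rw [← hker, MonoidHom.mem_ker, map_mul, map_inv, hcb, inv_mul_cancel]
    have h4 : c * φ k = φ k * c := Subgroup.mem_centralizer_singleton_iff.mp (h1 hc)
    have h5 := Subgroup.mem_center_iff.mp h3 (φ k)
    calc b * φ k = c * (c⁻¹ * b * φ k) := by group
      _ = c * φ k * (c⁻¹ * b) := by rw [← h5, mul_assoc]
      _ = φ k * b := by rw [h4]; group
  rwa [← hker, MonoidHom.mem_ker, ← MonoidHom.comp_apply, hπφ] at hZ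

end Criterion

/-! ### Nilpotent products and normal forms of `B` -/

section NilpotentProducts

theorem NilpotentProduct.closure_range_of {ι : Type w} (k : ℕ) {A : ι → Type v}
    [∀ i, Group (A i)] {x : (i : ι) → A i} (hx : ∀ i, ∀ b : A i, b ∈ Subgroup.zpowers (x i)) :
    Subgroup.closure (Set.range fun i => NilpotentProduct.of k (x i)) = ⊤ := by
  rw [eq_top_iff]
  intro d _
  obtain ⟨m, rfl⟩ := QuotientGroup.mk'_surjective _ d
  induction m using Monoid.CoprodI.induction_on with
  | one => rw [map_one]; exact one_mem _
  | of i b =>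
    obtain ⟨t, rfl⟩ := hx i b
    rw [map_zpow, map_zpow]
    exact Subgroup.zpow_mem _ (Subgroup.subset_closure (Set.mem_range_self i)) _
  | mul a b ha hb =>
    rw [map_mul]
    exact mul_mem (ha trivial) (hb trivial)

theorem NilpotentProduct.lowerCentralSeries_eq_bot {ι : Type w} (k : ℕ) (A : ι → Type v)
    [∀ i, Group (A i)] : (⊤ : Subgroup (NilpotentProduct k A)).lowerCentralSeries k = ⊥ := by
  rw [← Subgroup.map_top_of_surjective _ (QuotientGroup.mk'_surjective
    ((⊤ : Subgroup (Monoid.CoprodI A)).lowerCentralSeries k)), ← Subgroup.map_lowerCentralSeries,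
    QuotientGroup.map_mk'_self]

/-- Every element of the basic commutator subgroup is a product of powers of the basic
commutators, with exponents below `p`. -/
theorem exists_basicCommutatorProduct_eq {p : ℕ} (hp : p.Prime) (hodd : Odd p) {n : ℕ}
    {A : Fin n → Type v} [∀ i, Group (A i)] {x : (i : Fin n) → A i} (hxp : ∀ i, x i ^ p = 1)
    {b : NilpotentProduct 3 A} (hb : b ∈ basicCommutatorSubgroup x) :
    ∃ a : Fin n → Fin n → ℕ, (∀ i j, a j i < p) ∧ b = basicCommutatorProduct x a := by
  have hK := NilpotentProduct.lowerCentralSeries_eq_bot 3 A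
  let c : Fin n × Fin n → NilpotentProduct 3 A := fun t =>
    comm (NilpotentProduct.of 3 (x t.2)) (NilpotentProduct.of 3 (x t.1))
  -- The pairs are listed in the order of the factors in `basicCommutatorProduct`.
  let l : List (Fin n × Fin n) := (List.finRange n).flatMap fun i =>
    ((List.finRange n).filter fun j => i < j).map fun j => (i, j)
  have hl : l.Nodup := by
    refine List.nodup_flatMap.mpr ⟨fun i _ => ?_, ?_⟩
    · exact ((List.nodup_finRange n).filter _).map fun j j' h => congrArg Prod.snd h
    · refine (List.nodup_finRange n).imp fun {i i'} hne => ?_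
      rw [Function.onFun, List.disjoint_left]
      simp only [List.mem_map]
      rintro _ ⟨j, -, rfl⟩ ⟨j', -, h⟩
      exact hne (congrArg Prod.fst h).symm
  have hset : {d | ∃ i j, i < j ∧ d = comm (NilpotentProduct.of 3 (x j))
      (NilpotentProduct.of 3 (x i))} = {d | ∃ t ∈ l, d = c t} := by
    ext d
    simp [l, c]
  rw [basicCommutatorSubgroup, hset] at hb
  obtain ⟨a, ha, rfl⟩ := exists_list_prod_of_mem_closure hp.pos
    (fun s t => commutator_commute_of_class_le_three hK
      (comm_mem_commutator (Subgroup.mem_top _) (Subgroup.mem_top _))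
      (comm_mem_commutator (Subgroup.mem_top _) (Subgroup.mem_top _)))
    (fun t => comm_pow_eq_one hp hodd hK (by rw [← map_pow, hxp, map_one]) _) hl hb
  refine ⟨fun j i => a (i, j), fun i j => ha _, ?_⟩
  simp only [basicCommutatorProduct, l, List.map_flatMap, List.map_map, Function.comp_def]

theorem basicCommutatorProduct_mem {n : ℕ} {A : Fin n → Type v} [∀ i, Group (A i)]
    (x : (i : Fin n) → A i) (a : Fin n → Fin n → ℕ) :
    basicCommutatorProduct x a ∈ basicCommutatorSubgroup x := by
  refine Subgroup.list_prod_mem _ fun d hd => ?_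
  simp only [List.mem_flatMap, List.mem_map, List.mem_filter, decide_eq_true_eq] at hd
  obtain ⟨i, -, j, ⟨-, hij⟩, rfl⟩ := hd
  exact Subgroup.pow_mem _ (Subgroup.subset_closure (by exact ⟨i, j, hij, rfl⟩)) _

end NilpotentProducts

end Capability

/-! ### The two criteria -/

theorem mainTheorem12 {p : ℕ} (hp : p.Prime) (hodd : Odd p)
    {n : ℕ} (hn : 1 < n)
    {G : Type u} [Group G]
    (hclass : (⊤ : Subgroup G).lowerCentralSeries 2 = ⊥)
    (hexp : Monoid.exponent G = p)
    (g : Fin n → G)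
    (hgen : Subgroup.closure (Set.range g) = ⊤)
    (hmin : ∀ (m : ℕ) (h : Fin m → G), Subgroup.closure (Set.range h) = ⊤ → n ≤ m)
    {A : Fin n → Type v} [∀ i, Group (A i)]
    (hA : ∀ i, Nat.card (A i) = p)
    (x : (i : Fin n) → A i)
    (hx : ∀ i, ∀ b : A i, b ∈ Subgroup.zpowers (x i))
    (N : Subgroup (Capability.NilpotentProduct 2 A))
    (hN : N = (Capability.NilpotentProduct.induced 2 hx
      (fun i => Capability.orderOf_dvd_of_card_eq hexp (hA i) (hx i) (g i)) hclass).ker) :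
    (Capability.IsCapable G ↔
      ∀ a : Fin n → Fin n → ℕ, (∀ i j, i < j → a j i < p) →
        (∀ i, Capability.comm (Capability.basicCommutatorProduct x a)
            (Capability.NilpotentProduct.of 3 (x i)) ∈
          ⁅Capability.liftedSubgroup x N, (⊤ : Subgroup (Capability.NilpotentProduct 3 A))⁆) →
        Capability.basicCommutatorProduct x a ∈ Capability.liftedSubgroup x N) ∧
    (Capability.IsCapable G ↔
      Nonempty (G ≃* Capability.Candidate x N ⧸
        Subgroup.center (Capability.Candidate x N))) := by
  open Capability in
  have hord : ∀ i, orderOf (x i) = p := fun i => by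
    rw [orderOf_eq_card_of_forall_mem_zpowers (hx i), hA]
  have hxp : ∀ i, x i ^ p = 1 := fun i => hord i ▸ pow_orderOf_eq_one (x i)
  have hgp : ∀ i, g i ^ p = 1 := fun i => hexp ▸ Monoid.pow_exponent_eq_one (g i)
  let y : Fin n → NilpotentProduct 3 A := fun i => NilpotentProduct.of 3 (x i)
  have hy : Subgroup.closure (Set.range y) = ⊤ := NilpotentProduct.closure_range_of 3 hx
  have hyp : ∀ i, y i ^ p = 1 := fun i => by
    simp only [y, ← map_pow, hxp, map_one]
  have hK := NilpotentProduct.lowerCentralSeries_eq_bot 3 A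
  let f : NilpotentProduct 3 A →* G := (NilpotentProduct.induced 2 hx
      (fun i => orderOf_dvd_of_card_eq hexp (hA i) (hx i) (g i)) hclass).comp
    (NilpotentProduct.proj A)
  have hf : ∀ i, f (y i) = g i := fun i => NilpotentProduct.induced_of 2 hx
    (fun i => orderOf_dvd_of_card_eq hexp (hA i) (hx i) (g i)) hclass i
  have hfs : Function.Surjective f := by
    rw [← MonoidHom.range_eq_top, MonoidHom.range_eq_map, ← hy, MonoidHom.map_closure,
      ← Set.range_comp, ← hgen]
    congr 2
    exact funext hf
  have hL : liftedSubgroup x N = basicCommutatorSubgroup x ⊓ f.ker := by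
    rw [liftedSubgroup, hN, MonoidHom.comap_ker]
  have hLker : liftedSubgroup x N ≤ f.ker := hL ▸ inf_le_right
  have h12 : IsCapable G → ∀ a : Fin n → Fin n → ℕ, (∀ i j, i < j → a j i < p) →
        (∀ i, comm (basicCommutatorProduct x a) (NilpotentProduct.of 3 (x i)) ∈
          ⁅liftedSubgroup x N, (⊤ : Subgroup (NilpotentProduct 3 A))⁆) →
        basicCommutatorProduct x a ∈ liftedSubgroup x N := by
    intro hG a _ ha
    rw [hL]
    refine ⟨basicCommutatorProduct_mem x a, ?_⟩
    refine hG.mem_ker_of_forall_comm_mem hp.pos hclass hgp hgen hy ?_ f hf hLker ha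
    intro E _ e he hE
    exact ⟨NilpotentProduct.induced 3 hx
      (fun i => (hord i).symm ▸ orderOf_dvd_of_pow_eq_one (he i)) hE,
      NilpotentProduct.induced_of 3 hx _ hE⟩
  have h23 : (∀ a : Fin n → Fin n → ℕ, (∀ i j, i < j → a j i < p) →
        (∀ i, comm (basicCommutatorProduct x a) (NilpotentProduct.of 3 (x i)) ∈
          ⁅liftedSubgroup x N, (⊤ : Subgroup (NilpotentProduct 3 A))⁆) →
        basicCommutatorProduct x a ∈ liftedSubgroup x N) →
      Nonempty (G ≃* Candidate x N ⧸ Subgroup.center (Candidate x N)) := by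
    intro hcond
    refine nonempty_mulEquiv_quotient_center hy f hfs ?_ ?_
    · exact (Subgroup.commutator_mono hLker le_rfl).trans (Subgroup.commutator_le_left _ _)
    · rw [hL] at hcond ⊢
      refine mem_ker_iff_forall_comm_mem rfl hK hclass hy f
        (ker_le_commutator hp hclass hgp hgen hmin hy hyp f hf) ?_ ?_
      · intro k hk
        refine mem_commutator_of_comm_mem hn hy hyp ?_ hk
        intro s hs
        have hH : (⊤ : Subgroup (Heisenberg (ZMod p))).lowerCentralSeries 3 = ⊥ :=
          eq_bot_mono (Subgroup.lowerCentralSeries_antitone _ (by norm_num : 2 ≤ 3))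
            Heisenberg.lowerCentralSeries_two
        exact ⟨NilpotentProduct.induced 3 hx
          (fun i => (hord i).symm ▸ orderOf_dvd_of_pow_eq_one (hs i)) hH,
          NilpotentProduct.induced_of 3 hx _ hH⟩
      · intro b hb hbc
        obtain ⟨a, ha, rfl⟩ := exists_basicCommutatorProduct_eq hp hodd hxp hb
        exact (hcond a (fun i j _ => ha i j) hbc).2
  have h31 : Nonempty (G ≃* Candidate x N ⧸ Subgroup.center (Candidate x N)) → IsCapable G := by
    rintro ⟨e⟩
    -- The candidate lives in the universe of the `A i`; countability carries it to that of `G`.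
    have : Countable (NilpotentProduct 3 A) := countable_of_closure_finite hy
    have : Countable (Candidate x N) := (QuotientGroup.mk'_surjective _).countable
    exact IsCapable.of_countable e
  exact ⟨⟨h12, fun h => h31 (h23 h)⟩, ⟨fun h => h23 (h12 h), h31⟩⟩
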